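/- Let $T$ be the infinite rooted binary tree whose vertices are the finite words over $\{0,1\}$, with root the empty word and with each word $t$ joined to $t0$ and $t1$, and let $W=\mathrm{Aut}(T)$ with its profinite topology (the inverse limit of the automorphism groups of the finite subtrees of words of length $\le n$). For $u,v\in W$ let $(u,v)\in W$ denote the element $0t\mapsto 0\,u(t)$, $1t\mapsto 1\,v(t)$, and let $\sigma\in W$ be the element of order $2$ given by $0t\mapsto 1t\mapsto 0t$. Products in $W$ are compositions of maps acting from the left. The standard odometer is the unique element $a\in W$ with $a=(a,1)\,\sigma$, and an odometer is an element of $W$ that is conjugate to $a$ under $W$. Fix an integer $r\ge 1$ and let $a_1,\dots,a_r\in W$ be the unique elements with $a_1=(a_r,1)\,\sigma$ and $a_i=(a_{i-1},1)$ for $2\le i\le r$. Let $G\subset W$ be the closed subgroup topologically generated by $a_1,\dots,a_r$, let $N$ be the normalizer of $G$ in $W$, and let $G_{\mathrm{ab}}=G/\overline{[G,G]}$ be the quotient of $G$ by the closure of its commutator subgroup. Then: (a) Any two odometers in $G$ are conjugate under $N$. (b) Any two odometers in $G$ with the same image in $G_{\mathrm{ab}}$ are conjugate under $G$. -/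

import Mathlib

namespace BinTree

/-- The infinite rooted binary tree `T`: its vertices are the finite words over `{0, 1}`
(`false` is `0`, `true` is `1`), and every word `t` is joined to `t0` and `t1`. -/
def T : SimpleGraph (List Bool) where
  Adj s t := (∃ b, t = s ++ [b]) ∨ (∃ b, s = t ++ [b])
  symm := ⟨fun _ _ h => h.symm⟩
  loopless := ⟨fun s h => by
    rcases h with ⟨b, h⟩ | ⟨b, h⟩ <;>
    · have := congrArg List.length h
      simp at this⟩

theorem adj_iff (s t : List Bool) :
    T.Adj s t ↔ (∃ b, t = s ++ [b]) ∨ (∃ b, s = t ++ [b]) := Iff.rfl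

/-- The group `W = Aut(T)`; the product is composition, `(g * h) t = g (h t)`. -/
abbrev W : Type := T ≃g T

/-- The profinite topology of `W`: the coarsest one for which every map `g ↦ g t`, for `t` a
vertex, is continuous into the discrete set of vertices. As the subtrees `T_n` of words of length
at most `n` are finite, this is the inverse limit topology of `W = lim Aut(T_n)`. -/
instance : TopologicalSpace W := ⨅ t : List Bool, TopologicalSpace.induced (fun g : W => g t) ⊥

theorem isOpen_eval (s t : List Bool) : IsOpen {g : W | g s = t} := by
  refine IsOpen.mono (t₂ := TopologicalSpace.induced (fun g : W => g s) ⊥) ?_ (iInf_le _ s)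
  exact ⟨{t}, trivial, rfl⟩

theorem continuous_of_eval {X : Type*} [TopologicalSpace X] (f : X → W)
    (h : ∀ x t, ∃ U : Set X, IsOpen U ∧ x ∈ U ∧ ∀ y ∈ U, f y t = f x t) : Continuous f := by
  refine continuous_iInf_rng.2 fun t => continuous_induced_rng.2 ?_
  let _ : TopologicalSpace (List Bool) := ⊥
  have h' : IsLocallyConstant fun x => f x t :=
    (IsLocallyConstant.iff_exists_open _).2 fun x => h x t
  exact h'.continuous

instance : IsTopologicalGroup W where
  continuous_mul := by
    refine continuous_of_eval _ fun x t => ?_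
    refine ⟨{y | y.2 t = x.2 t} ∩ {y | y.1 (x.2 t) = x.1 (x.2 t)},
      ((isOpen_eval _ _).preimage continuous_snd).inter
        ((isOpen_eval _ _).preimage continuous_fst), ⟨rfl, rfl⟩, ?_⟩
    rintro y ⟨h₁, h₂⟩
    simp only [Set.mem_ofPred_eq] at h₁ h₂
    simp [RelIso.mul_apply, h₁, h₂]
  continuous_inv := by
    refine continuous_of_eval _ fun x t => ⟨{y | y (x⁻¹ t) = t}, isOpen_eval _ _, ?_, ?_⟩
    · exact RelIso.apply_inv_self x t
    · intro y hy
      have := congrArg (fun s => y⁻¹ s) (show y (x⁻¹ t) = t from hy)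
      simpa [RelIso.inv_apply_self] using this.symm

/-- Every automorphism of `T` fixes the root. -/
theorem map_root (g : W) : g [] = [] := by
  by_contra hne
  obtain ⟨p, b, hp⟩ : ∃ p b, g [] = p ++ [b] := by
    rcases List.eq_nil_or_concat (g []) with h | ⟨p, b, h⟩
    · exact absurd h hne
    · exact ⟨p, b, by simpa using h⟩
  have key : ∀ s, T.Adj (g []) s → ∃ c, s = g [c] := by
    intro s hs
    have h : T.Adj [] (g.symm s) := by
      rw [← g.map_adj_iff]
      simpa using hs
    rcases h with ⟨c, h⟩ | ⟨c, h⟩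
    · exact ⟨c, by rw [← g.apply_symm_apply s, h]; rfl⟩
    · simp at h
  obtain ⟨c₀, h₀⟩ := key p (Or.inr ⟨b, hp⟩)
  obtain ⟨c₁, h₁⟩ := key (g [] ++ [false]) (Or.inl ⟨_, rfl⟩)
  obtain ⟨c₂, h₂⟩ := key (g [] ++ [true]) (Or.inl ⟨_, rfl⟩)
  have n₁ : c₀ ≠ c₁ := by
    rintro rfl
    have := congrArg List.length (h₀.trans h₁.symm)
    rw [hp] at this
    simp at this
  have n₂ : c₀ ≠ c₂ := by
    rintro rfl
    have := congrArg List.length (h₀.trans h₂.symm)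
    rw [hp] at this
    simp at this
  have n₃ : c₁ ≠ c₂ := by
    rintro rfl
    have := h₁.trans h₂.symm
    simp at this
  revert n₁ n₂ n₃
  cases c₀ <;> cases c₁ <;> cases c₂ <;> simp

/-- A permutation of the words that, together with its inverse, maps the two children of each
word `s` to children of the image of `s` is an automorphism of `T`. -/
def ofEquiv (e : List Bool ≃ List Bool) (h : ∀ s b, ∃ c, e (s ++ [b]) = e s ++ [c])
    (h' : ∀ s b, ∃ c, e.symm (s ++ [b]) = e.symm s ++ [c]) : W where
  toEquiv := e
  map_rel_iff' := by
    intro s t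
    rw [adj_iff, adj_iff]
    constructor
    · rintro (⟨b, hb⟩ | ⟨b, hb⟩)
      · left
        obtain ⟨c, hc⟩ := h' (e s) b
        exact ⟨c, by rw [← hb] at hc; simpa using hc⟩
      · right
        obtain ⟨c, hc⟩ := h' (e t) b
        exact ⟨c, by rw [← hb] at hc; simpa using hc⟩
    · rintro (⟨b, rfl⟩ | ⟨b, rfl⟩)
      · exact Or.inl (h s b)
      · exact Or.inr (h t b)

/-- The action of `(u, v)` on words: `0t ↦ 0u(t)` and `1t ↦ 1v(t)`. -/
def pairFun (u v : W) : List Bool → List Bool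
  | [] => []
  | false :: t => false :: u t
  | true :: t => true :: v t

theorem pairFun_inv (u v : W) (s : List Bool) : pairFun u⁻¹ v⁻¹ (pairFun u v s) = s := by
  rcases s with _ | ⟨_ | _, t⟩
  · rfl
  · simp [pairFun, RelIso.inv_apply_self]
  · simp [pairFun, RelIso.inv_apply_self]

theorem pairFun_adj (u v : W) (s t : List Bool) (h : T.Adj s t) :
    T.Adj (pairFun u v s) (pairFun u v t) := by
  have key : ∀ s b, T.Adj (pairFun u v s) (pairFun u v (s ++ [b])) := by
    intro s b
    rcases s with _ | ⟨c, s⟩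
    · cases b
      · exact Or.inl ⟨false, by simp [pairFun, map_root]⟩
      · exact Or.inl ⟨true, by simp [pairFun, map_root]⟩
    · have hu : T.Adj (u s) (u (s ++ [b])) := u.map_adj_iff.2 (Or.inl ⟨b, rfl⟩)
      have hv : T.Adj (v s) (v (s ++ [b])) := v.map_adj_iff.2 (Or.inl ⟨b, rfl⟩)
      cases c
      · rcases hu with ⟨d, hd⟩ | ⟨d, hd⟩
        · exact Or.inl ⟨d, by simp [pairFun, hd]⟩
        · exact Or.inr ⟨d, by simp [pairFun, hd]⟩
      · rcases hv with ⟨d, hd⟩ | ⟨d, hd⟩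
        · exact Or.inl ⟨d, by simp [pairFun, hd]⟩
        · exact Or.inr ⟨d, by simp [pairFun, hd]⟩
  rcases h with ⟨b, rfl⟩ | ⟨b, rfl⟩
  · exact key s b
  · exact (key t b).symm

/-- The element `(u, v)` of `W`, acting by `u` on the half tree of the words `0t` and by `v` on
the half tree of the words `1t`. -/
def pair (u v : W) : W where
  toFun := pairFun u v
  invFun := pairFun u⁻¹ v⁻¹
  left_inv := pairFun_inv u v
  right_inv s := by simpa using pairFun_inv u⁻¹ v⁻¹ s
  map_rel_iff' := by
    intro s t
    constructor
    · intro h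
      have := pairFun_adj u⁻¹ v⁻¹ _ _ h
      simpa [pairFun_inv] using this
    · exact pairFun_adj u v s t

/-- The action of `σ` on words. -/
def swapFun : List Bool → List Bool
  | [] => []
  | b :: t => (!b) :: t

theorem swapFun_swapFun (s : List Bool) : swapFun (swapFun s) = s := by
  cases s <;> simp [swapFun]

theorem swapFun_append (s : List Bool) (b : Bool) :
    ∃ c, swapFun (s ++ [b]) = swapFun s ++ [c] := by
  cases s <;> simp [swapFun]

/-- The element `σ` of order `2` that interchanges the two half trees: `0t ↦ 1t ↦ 0t`. -/
def swap : W :=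
  ofEquiv ⟨swapFun, swapFun, swapFun_swapFun, swapFun_swapFun⟩ swapFun_append swapFun_append

/-- The action on words of the generators; see `gen`, `gen_first`, `gen_next`. -/
def genFun (r : ℕ) [NeZero r] : Fin r → List Bool → List Bool
  | _, [] => []
  | i, false :: t => if i = 0 then true :: t else false :: genFun r (i - 1) t
  | i, true :: t => if i = 0 then false :: genFun r (i - 1) t else true :: t

/-- The action on words of the inverses of the generators. -/
def genInvFun (r : ℕ) [NeZero r] : Fin r → List Bool → List Bool
  | _, [] => []
  | i, false :: t => if i = 0 then true :: genInvFun r (i - 1) t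
      else false :: genInvFun r (i - 1) t
  | i, true :: t => if i = 0 then false :: t else true :: t

theorem genInvFun_genFun (r : ℕ) [NeZero r] (i : Fin r) (s : List Bool) :
    genInvFun r i (genFun r i s) = s := by
  induction s generalizing i with
  | nil => rfl
  | cons b t ih =>
    by_cases hi : i = 0 <;> cases b <;> simp [genFun, genInvFun, hi, ih]

theorem genFun_genInvFun (r : ℕ) [NeZero r] (i : Fin r) (s : List Bool) :
    genFun r i (genInvFun r i s) = s := by
  induction s generalizing i with
  | nil => rfl
  | cons b t ih =>
    by_cases hi : i = 0 <;> cases b <;> simp [genFun, genInvFun, hi, ih]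

theorem genFun_append (r : ℕ) [NeZero r] (i : Fin r) (s : List Bool) (b : Bool) :
    ∃ c, genFun r i (s ++ [b]) = genFun r i s ++ [c] := by
  induction s generalizing i with
  | nil => by_cases hi : i = 0 <;> cases b <;> simp [genFun, hi]
  | cons c t ih =>
    obtain ⟨d, hd⟩ := ih (i - 1)
    by_cases hi : i = 0
    · subst hi
      cases c <;> simp only [List.cons_append, genFun, if_true, hd] <;> exact ⟨_, rfl⟩
    · cases c <;> simp [genFun, hi, hd]

theorem genInvFun_append (r : ℕ) [NeZero r] (i : Fin r) (s : List Bool) (b : Bool) :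
    ∃ c, genInvFun r i (s ++ [b]) = genInvFun r i s ++ [c] := by
  induction s generalizing i with
  | nil => by_cases hi : i = 0 <;> cases b <;> simp [genInvFun, hi]
  | cons c t ih =>
    obtain ⟨d, hd⟩ := ih (i - 1)
    by_cases hi : i = 0
    · subst hi
      cases c <;> simp only [List.cons_append, genInvFun, if_true, hd] <;> exact ⟨_, rfl⟩
    · cases c <;> simp [genInvFun, hi, hd]

/-- The generators, indexed from `0`: `gen r ⟨i - 1, _⟩` is `a_i` for `1 ≤ i ≤ r`, where
`a_1 = (a_r, 1) σ` and `a_i = (a_{i-1}, 1)` for `2 ≤ i ≤ r`. -/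
def gen (r : ℕ) [NeZero r] (i : Fin r) : W :=
  ofEquiv ⟨genFun r i, genInvFun r i, genInvFun_genFun r i, genFun_genInvFun r i⟩
    (genFun_append r i) (genInvFun_append r i)

theorem gen_first (r : ℕ) [NeZero r] :
    gen r 0 = pair (gen r ⟨r - 1, Nat.sub_one_lt (NeZero.ne r)⟩) 1 * swap := by
  have h : (0 : Fin r) - 1 = ⟨r - 1, Nat.sub_one_lt (NeZero.ne r)⟩ := by
    obtain ⟨n, rfl⟩ := Nat.exists_eq_succ_of_ne_zero (NeZero.ne r)
    rcases n with _ | n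
    · rfl
    · ext
      simp
  ext1 s
  change genFun r 0 s = pairFun _ 1 (swapFun s)
  rcases s with _ | ⟨_ | _, t⟩
  · rfl
  · simp [genFun, pairFun, swapFun]
  · simp only [genFun, pairFun, swapFun, if_true, Bool.not_true, h]
    rfl

theorem gen_next (r : ℕ) [NeZero r] (i : ℕ) (hi : i + 1 < r) :
    gen r ⟨i + 1, hi⟩ = pair (gen r ⟨i, Nat.lt_of_succ_lt hi⟩) 1 := by
  have h0 : (⟨i + 1, hi⟩ : Fin r) ≠ 0 := by
    intro h
    have := congrArg Fin.val h
    simp at this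
  have h : (⟨i + 1, hi⟩ : Fin r) - 1 = ⟨i, Nat.lt_of_succ_lt hi⟩ := by
    rw [sub_eq_iff_eq_add]
    ext
    have h1 : 1 % r = 1 := Nat.mod_eq_of_lt (by omega)
    simp [Fin.val_add, h1, Nat.mod_eq_of_lt hi]
  ext1 s
  change genFun r _ s = pairFun _ 1 s
  rcases s with _ | ⟨_ | _, t⟩
  · rfl
  · simp only [genFun, pairFun, h0, if_false, h]
    rfl
  · simp [genFun, pairFun, h0]

/-- The group `G`, the closed subgroup of `W` topologically generated by `a_1, …, a_r`. -/
def G (r : ℕ) [NeZero r] : Subgroup W :=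
  (Subgroup.closure (Set.range (gen r))).topologicalClosure

/-- The normalizer `N` of `G` in `W`. -/
def N (r : ℕ) [NeZero r] : Subgroup W := Subgroup.normalizer (G r)

/-- The standard odometer (adding machine) `a`, characterized by `a = (a, 1) σ`. -/
def stdOdometer : W := gen 1 0

theorem stdOdometer_eq : stdOdometer = pair stdOdometer 1 * swap := gen_first 1

/-- An odometer is an element of `W` that is conjugate under `W` to the standard odometer. -/
def IsOdometer (w : W) : Prop := IsConj stdOdometer w

end BinTree

/-! ### Sections, signs and finite levels of tree automorphisms -/

namespace BinTree

/-! Of an odometer only one property is used: it acts with sign $-1$ on every level. Let $H$ be the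
closed normal subgroup of $G$ generated by $a_1,\dots,a_{r-1}$. Then $G$ contains the diagonal of
$G\times G$ as well as $H\times H$, and the commutators of $G$ lie both in $H$ and in $H\times H$.

For (b), write $c=(u,v)\sigma$ and $c'=(u',v')\sigma$. Conjugating $c$ by $(x,y)$ with $y=u'^{-1}xu$
gives $c'$ exactly when $x(uv)x^{-1}=u'v'$. The products $uv$ and $u'v'$ inherit all signs $-1$ and
have the same class in $G_{\mathrm{ab}}$, so induction on the level supplies $x\in G$, and $(x,y)\in
G$ because $x^{-1}y\in H$. Compactness turns conjugacy on all levels into conjugacy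
(`exists_lvl_conj`, `exists_conj_of_mk_eq`).

For (a), any odd exponents $k_i$ are realized by some $w\in N$ such that $wa_iw^{-1}$ is conjugate
under $G$ to $a_i^{k_i}$ (`exists_conj_gen`). On a fixed level, and modulo commutators, an odometer
in $G$ is a product of powers $a_i^{l_i}$; the signs on the first $r$ levels force all $l_i$ to be
odd. Hence some such $w$ matches the classes of two odometers on that level, and (b) together with
compactness finishes. -/

theorem exists_map_append (g : W) (s : List Bool) (b : Bool) :
    ∃ c, g (s ++ [b]) = g s ++ [c] := by
  induction s using List.reverseRecOn generalizing b with
  | nil =>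
    rcases g.map_adj_iff.2 (show T.Adj [] ([] ++ [b]) from Or.inl ⟨b, rfl⟩) with h | ⟨c, h⟩
    · exact h
    · simp [map_root] at h
  | append_singleton p d ih =>
    obtain ⟨e, he⟩ := ih d
    rcases g.map_adj_iff.2 (show T.Adj (p ++ [d]) (p ++ [d] ++ [b]) from Or.inl ⟨b, rfl⟩)
      with h | ⟨c, h⟩
    · exact h
    · rw [he] at h
      have h2 := g.injective (List.append_inj' h rfl).1
      have := congrArg List.length h2
      simp at this

theorem length_map (g : W) (s : List Bool) : (g s).length = s.length := by
  induction s using List.reverseRecOn with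
  | nil => simp [map_root]
  | append_singleton p d ih =>
    obtain ⟨e, he⟩ := exists_map_append g p d
    simp [he, ih]

/-- The action of an automorphism on the first letter of a word. -/
def act (g : W) (b : Bool) : Bool := (g [b]).headD false

theorem map_cons_tail (g : W) (b : Bool) (t : List Bool) :
    g (b :: t) = act g b :: (g (b :: t)).tail := by
  induction t using List.reverseRecOn with
  | nil =>
    have h := length_map g [b]
    obtain ⟨c, hc⟩ := List.length_eq_one_iff.1 h
    simp [act, hc]
  | append_singleton p d ih =>
    obtain ⟨e, he⟩ := exists_map_append g (b :: p) d
    rw [← List.cons_append, he, ih]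
    simp

theorem inv_map_map (g : W) (t : List Bool) : g⁻¹ (g t) = t := RelIso.inv_apply_self g t

theorem map_inv_map (g : W) (t : List Bool) : g (g⁻¹ t) = t := RelIso.apply_inv_self g t

theorem mul_map (g h : W) (t : List Bool) : (g * h) t = g (h t) := rfl

theorem map_singleton (g : W) (b : Bool) : g [b] = [act g b] := by
  have h := length_map g [b]
  obtain ⟨c, hc⟩ := List.length_eq_one_iff.1 h
  simp [act, hc]

theorem act_mul (g h : W) (b : Bool) : act (g * h) b = act g (act h b) := by
  have := map_singleton (g * h) b
  rw [mul_map, map_singleton, map_singleton] at this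
  simpa using this.symm

theorem act_one (b : Bool) : act 1 b = b := rfl

theorem act_inv_act (g : W) (b : Bool) : act g⁻¹ (act g b) = b := by
  rw [← act_mul, inv_mul_cancel, act_one]

theorem act_true (g : W) : act g true = !act g false := by
  have h : act g true ≠ act g false := fun h => by
    have := congrArg (act g⁻¹) h
    simp [act_inv_act] at this
  revert h
  cases act g true <;> cases act g false <;> simp

/-- The section of an automorphism at a child of the root: `g (b t) = (act g b) (sec g b t)`. -/
def sec (g : W) (b : Bool) : W :=
  ofEquiv
    { toFun := fun t => (g (b :: t)).tail
      invFun := fun t => (g⁻¹ (act g b :: t)).tail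
      left_inv := fun t => by
        change (g⁻¹ (act g b :: (g (b :: t)).tail)).tail = t
        rw [← map_cons_tail, inv_map_map, List.tail_cons]
      right_inv := fun t => by
        have h := map_cons_tail g⁻¹ (act g b) t
        rw [act_inv_act] at h
        change (g (b :: (g⁻¹ (act g b :: t)).tail)).tail = t
        rw [← h, map_inv_map, List.tail_cons] }
    (fun s d => by
      obtain ⟨c, hc⟩ := exists_map_append g (b :: s) d
      refine ⟨c, ?_⟩
      change (g (b :: s ++ [d])).tail = (g (b :: s)).tail ++ [c]
      rw [hc, map_cons_tail]
      rfl)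
    (fun s d => by
      obtain ⟨c, hc⟩ := exists_map_append g⁻¹ (act g b :: s) d
      refine ⟨c, ?_⟩
      change (g⁻¹ (act g b :: s ++ [d])).tail = (g⁻¹ (act g b :: s)).tail ++ [c]
      rw [hc, map_cons_tail]
      rfl)

theorem map_cons (g : W) (b : Bool) (t : List Bool) : g (b :: t) = act g b :: sec g b t :=
  map_cons_tail g b t

theorem eq_sec {g : W} {b c : Bool} {u : W} (h : ∀ t, g (b :: t) = c :: u t) : sec g b = u := by
  ext1 t
  have := h t
  rw [map_cons] at this
  exact (List.cons.inj this).2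

theorem sec_mul (g h : W) (b : Bool) : sec (g * h) b = sec g (act h b) * sec h b := by
  apply eq_sec (c := act g (act h b))
  intro t
  rw [mul_map, map_cons h, map_cons g, mul_map]

theorem sec_one (b : Bool) : sec 1 b = 1 := rfl

theorem sec_inv (g : W) (b : Bool) : sec g⁻¹ b = (sec g (act g⁻¹ b))⁻¹ := by
  have h := sec_mul g g⁻¹ b
  rw [mul_inv_cancel, sec_one] at h
  exact eq_inv_of_mul_eq_one_right h.symm

theorem pair_mul_pair (u v u' v' : W) : pair u v * pair u' v' = pair (u * u') (v * v') := by
  ext1 t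
  rcases t with _ | ⟨_ | _, t⟩ <;> rfl

theorem pair_one_one : pair 1 1 = 1 := by
  ext1 t
  rcases t with _ | ⟨_ | _, t⟩ <;> rfl

theorem pair_inv (u v : W) : (pair u v)⁻¹ = pair u⁻¹ v⁻¹ := rfl

theorem swap_mul_swap : swap * swap = 1 := by
  ext1 t
  exact swapFun_swapFun t

theorem swap_inv : swap⁻¹ = swap := rfl

theorem swap_mul_pair (u v : W) : swap * pair u v = pair v u * swap := by
  ext1 t
  rcases t with _ | ⟨_ | _, t⟩ <;> rfl

/-- `pair` as a homomorphism. -/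
def pairHom : W × W →* W where
  toFun p := pair p.1 p.2
  map_one' := pair_one_one
  map_mul' p q := (pair_mul_pair p.1 p.2 q.1 q.2).symm

theorem act_pair (u v : W) (b : Bool) : act (pair u v) b = b := by
  cases b
  · change (false :: u []).headD false = false
    rfl
  · change (true :: v []).headD false = true
    rfl

theorem act_swap (b : Bool) : act swap b = !b := by cases b <;> rfl

theorem sec_pair_false (u v : W) : sec (pair u v) false = u := rfl

theorem sec_pair_true (u v : W) : sec (pair u v) true = v := rfl

theorem sec_pair_mul_swap_false (u v : W) : sec (pair u v * swap) false = v := rfl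

theorem sec_pair_mul_swap_true (u v : W) : sec (pair u v * swap) true = u := rfl

theorem act_pair_mul_swap (u v : W) (b : Bool) : act (pair u v * swap) b = !b := by
  rw [act_mul, act_pair, act_swap]

theorem eq_pair {g : W} (h : act g false = false) : g = pair (sec g false) (sec g true) := by
  have h' := act_true g
  ext1 t
  rcases t with _ | ⟨_ | _, t⟩
  · exact map_root g
  · rw [map_cons, h]; rfl
  · rw [map_cons, h', h]; rfl

theorem eq_pair_mul_swap {g : W} (h : act g false = true) :
    g = pair (sec g true) (sec g false) * swap := by
  have h' := act_true g
  ext1 t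
  rcases t with _ | ⟨_ | _, t⟩
  · exact map_root g
  · rw [map_cons, h]; rfl
  · rw [map_cons, h', h]; rfl

theorem pair_injective {u v u' v' : W} (h : pair u v = pair u' v') : u = u' ∧ v = v' :=
  ⟨congrArg (fun g => sec g false) h, congrArg (fun g => sec g true) h⟩

/-- The sign of the action on the `(n+1)`-st level, written recursively. -/
def sgn : ℕ → W → ℤˣ
  | 0, g => if act g false then -1 else 1
  | n + 1, g => sgn n (sec g false) * sgn n (sec g true)

theorem sgn_mul (n : ℕ) (g h : W) : sgn n (g * h) = sgn n g * sgn n h := by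
  induction n generalizing g h with
  | zero =>
    have hg := act_true g
    simp only [sgn, act_mul]
    cases hh : act h false <;> cases hg' : act g false <;> simp_all
  | succ n ih =>
    have hh := act_true h
    simp only [sgn, sec_mul, ih]
    cases h' : act h false <;> simp only [h', Bool.not_true, Bool.not_false] at hh <;>
      rw [hh] <;> simp only [mul_comm, mul_left_comm]

/-- `sgn` as a homomorphism. -/
def sgnHom (n : ℕ) : W →* ℤˣ := MonoidHom.mk' (sgn n) (sgn_mul n)

theorem sgn_conj (n : ℕ) (g h : W) : sgn n (g * h * g⁻¹) = sgn n h := by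
  change sgnHom n _ = sgnHom n _
  rw [map_mul, map_mul, map_inv, mul_inv_cancel_comm]

/-- The stabilizer of all words of length at most `n`. -/
def levelStab (n : ℕ) : Subgroup W where
  carrier := {g | ∀ t : List Bool, t.length ≤ n → g t = t}
  one_mem' := fun _ _ => rfl
  mul_mem' := fun {a b} ha hb t ht => by rw [mul_map, hb t ht, ha t ht]
  inv_mem' := fun {a} ha t ht => by
    have := congrArg (a⁻¹ : W) (ha t ht)
    rw [inv_map_map] at this
    exact this.symm

instance (n : ℕ) : (levelStab n).Normal where
  conj_mem := fun a ha g t ht => by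
    have h : (g⁻¹ t).length ≤ n := by rwa [length_map]
    rw [mul_map, mul_map, ha _ h, map_inv_map]

/-- The restriction of an automorphism to the words of length at most `n`. -/
def lvl (n : ℕ) : W →* W ⧸ levelStab n := QuotientGroup.mk' (levelStab n)

theorem lvl_eq_iff {n : ℕ} {g h : W} :
    lvl n g = lvl n h ↔ ∀ t : List Bool, t.length ≤ n → g t = h t := by
  refine QuotientGroup.eq.trans ⟨fun H t ht => ?_, fun H t ht => ?_⟩
  · have := congrArg g (H t ht)
    rw [mul_map, map_inv_map] at this
    exact this.symm
  · rw [mul_map, ← H t ht, inv_map_map]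

theorem lvl_mono {m n : ℕ} (hmn : m ≤ n) {g h : W} (H : lvl n g = lvl n h) :
    lvl m g = lvl m h :=
  lvl_eq_iff.2 fun t ht => lvl_eq_iff.1 H t (ht.trans hmn)

theorem lvl_zero (g h : W) : lvl 0 g = lvl 0 h :=
  lvl_eq_iff.2 fun t ht => by
    obtain rfl : t = [] := by simpa using ht
    rw [map_root, map_root]

theorem eq_of_lvl {g h : W} (H : ∀ n, lvl n g = lvl n h) : g = h := by
  ext1 t
  exact lvl_eq_iff.1 (H t.length) t le_rfl

theorem lvl_pair {n : ℕ} {u v u' v' : W} (hu : lvl n u = lvl n u') (hv : lvl n v = lvl n v') :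
    lvl (n + 1) (pair u v) = lvl (n + 1) (pair u' v') := by
  rw [lvl_eq_iff] at *
  rintro (_ | ⟨_ | _, t⟩) ht
  · rfl
  · exact congrArg (List.cons false) (hu t (by simpa using ht))
  · exact congrArg (List.cons true) (hv t (by simpa using ht))

theorem act_eq_of_lvl {n : ℕ} {g h : W} (H : lvl (n + 1) g = lvl (n + 1) h) (b : Bool) :
    act g b = act h b := by
  rw [act, act, lvl_eq_iff.1 H [b] (by simp)]

theorem lvl_sec {n : ℕ} {g h : W} (H : lvl (n + 1) g = lvl (n + 1) h) (b : Bool) :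
    lvl n (sec g b) = lvl n (sec h b) := by
  rw [lvl_eq_iff] at *
  intro t ht
  have := H (b :: t) (by simpa using ht)
  rw [map_cons, map_cons] at this
  exact (List.cons.inj this).2

theorem sgn_eq_of_lvl {n : ℕ} {g h : W} (H : lvl (n + 1) g = lvl (n + 1) h) :
    sgn n g = sgn n h := by
  induction n generalizing g h with
  | zero => simp only [sgn, act_eq_of_lvl H]
  | succ n ih => simp only [sgn, ih (lvl_sec H _)]

/-- The square of `g` fixes both half trees, so each level costs one factor 2 in the exponent. -/
theorem lvl_pow (n : ℕ) (g : W) : lvl n (g ^ 2 ^ n) = 1 := by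
  rw [← map_one (lvl n)]
  induction n generalizing g with
  | zero => exact lvl_zero _ _
  | succ n ih =>
    have key : ∀ u v : W, lvl (n + 1) (pair u v ^ 2 ^ n) = lvl (n + 1) 1 := fun u v => by
      have : pair u v ^ 2 ^ n = pair (u ^ 2 ^ n) (v ^ 2 ^ n) :=
        (map_pow pairHom (u, v) (2 ^ n)).symm
      rw [this, ← pair_one_one]
      exact lvl_pair (ih u) (ih v)
    have h2 : act (g ^ 2) false = false := by
      have hg := act_true g
      rw [pow_two, act_mul]
      cases h : act g false <;> simp [h, hg]
    rw [pow_succ', pow_mul, eq_pair h2]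
    exact key _ _

end BinTree

/-! ### Compactness of $W$ and limit arguments -/

namespace BinTree

open Filter Topology

theorem isOpen_lvl (n : ℕ) (h : W) : IsOpen {g : W | lvl n g = lvl n h} := by
  have : {g : W | lvl n g = lvl n h} =
      ⋂ t ∈ {t : List Bool | t.length ≤ n}, {g : W | g t = h t} := by
    ext g
    simp [lvl_eq_iff]
  rw [this]
  exact (List.finite_length_le Bool n).isOpen_biInter fun t _ => isOpen_eval t _

instance (n : ℕ) : DiscreteTopology (W ⧸ levelStab n) := by
  refine QuotientGroup.discreteTopology ?_
  convert isOpen_lvl n 1 using 1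
  ext g
  change _ ↔ lvl n g = lvl n 1
  rw [map_one, lvl, QuotientGroup.mk'_apply, QuotientGroup.eq_one_iff]
  rfl

theorem continuous_lvl (n : ℕ) : Continuous (lvl n) := QuotientGroup.continuous_mk

instance : T2Space W :=
  T2Space.of_injective_continuous (f := fun g n => lvl n g)
    (fun _ _ h => eq_of_lvl fun n => congrFun h n) (continuous_pi continuous_lvl)

theorem nhds_eq (g : W) : 𝓝 g = ⨅ t : List Bool, 𝓟 {h : W | h t = g t} := by
  rw [nhds_iInf]
  refine iInf_congr fun t => ?_
  let _ : TopologicalSpace (List Bool) := ⊥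
  have : DiscreteTopology (List Bool) := ⟨rfl⟩
  rw [nhds_induced, nhds_discrete, ← principal_singleton, comap_principal]
  rfl

/-- A word has only finitely many possible images, so along an ultrafilter `g t` and `g⁻¹ t` are
eventually constant; these constants define the limit and its inverse. -/
instance : CompactSpace W := by
  refine ⟨isCompact_iff_ultrafilter_le_nhds.2 fun F _ => ?_⟩
  have key : ∀ (φ : W → W) (t : List Bool), ∃ s, ∀ᶠ g in (F : Filter W), φ g t = s := by
    intro φ t
    have hfin := List.finite_length_le Bool t.length
    have : ∀ᶠ g in (F : Filter W), ∃ s ∈ {s : List Bool | s.length ≤ t.length}, φ g t = s :=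
      Eventually.of_forall fun g => ⟨_, (length_map _ t).le, rfl⟩
    obtain ⟨s, -, hs⟩ := (Ultrafilter.eventually_exists_mem_iff hfin).1 this
    exact ⟨s, hs⟩
  choose f hf using key id
  choose f' hf' using key fun g => g⁻¹
  have h1 : ∀ t, f' (f t) = t := fun t => by
    obtain ⟨g, hg, hg'⟩ := ((hf t).and (hf' (f t))).exists
    rw [← hg', ← hg]
    exact inv_map_map g t
  have h2 : ∀ t, f (f' t) = t := fun t => by
    obtain ⟨g, hg, hg'⟩ := ((hf' t).and (hf (f' t))).exists
    rw [← hg', ← hg]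
    exact map_inv_map g t
  refine ⟨ofEquiv ⟨f, f', h1, h2⟩ (fun s b => ?_) (fun s b => ?_), trivial, ?_⟩
  · obtain ⟨g, hg, hg'⟩ := ((hf s).and (hf (s ++ [b]))).exists
    obtain ⟨c, hc⟩ := exists_map_append g s b
    exact ⟨c, hg'.symm.trans (hc.trans (congrArg (· ++ [c]) hg))⟩
  · obtain ⟨g, hg, hg'⟩ := ((hf' s).and (hf' (s ++ [b]))).exists
    obtain ⟨c, hc⟩ := exists_map_append g⁻¹ s b
    exact ⟨c, hg'.symm.trans (hc.trans (congrArg (· ++ [c]) hg))⟩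
  · rw [nhds_eq]
    exact le_iInf fun t => le_principal_iff.2 (hf t)

theorem continuous_pair : Continuous fun p : W × W => pair p.1 p.2 := by
  refine continuous_of_eval _ fun p t => ?_
  rcases t with _ | ⟨_ | _, t⟩
  · exact ⟨Set.univ, isOpen_univ, trivial, fun _ _ => rfl⟩
  · exact ⟨_, (isOpen_eval t (p.1 t)).preimage continuous_fst, rfl,
      fun q hq => congrArg (List.cons false) hq⟩
  · exact ⟨_, (isOpen_eval t (p.2 t)).preimage continuous_snd, rfl,
      fun q hq => congrArg (List.cons true) hq⟩

theorem continuous_sec (b : Bool) : Continuous fun g : W => sec g b := by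
  refine continuous_of_eval _ fun g t => ⟨_, isOpen_eval (b :: t) (g (b :: t)), rfl, ?_⟩
  intro h hh
  change h (b :: t) = g (b :: t) at hh
  change (h (b :: t)).tail = (g (b :: t)).tail
  rw [hh]

theorem exists_lvl_eq_of_mem_closure {S : Subgroup W} {g : W} (hg : g ∈ S.topologicalClosure)
    (n : ℕ) : ∃ s ∈ S, lvl n s = lvl n g := by
  obtain ⟨s, hs, hs'⟩ := mem_closure_iff.1 hg _ (isOpen_lvl n g) rfl
  exact ⟨s, hs', hs⟩

/-- If `w` conjugates `c` to an element agreeing with `c'` on a given level, for suitable `w`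
in a closed set, then some `w` in this set conjugates `c` to `c'`. -/
theorem exists_conj_of_lvl {S : Set W} (hS : IsClosed S) {c c' : W}
    (H : ∀ n, ∃ w ∈ S, lvl n (w * c * w⁻¹) = lvl n c') : ∃ w ∈ S, w * c * w⁻¹ = c' := by
  have hc : ∀ n, IsClosed (S ∩ {w | lvl n (w * c * w⁻¹) = lvl n c'}) := fun n =>
    hS.inter (isClosed_eq ((continuous_lvl n).comp (by fun_prop)) continuous_const)
  obtain ⟨w, hw⟩ := IsCompact.nonempty_iInter_of_sequence_nonempty_isCompact_isClosed
    (fun n => S ∩ {w | lvl n (w * c * w⁻¹) = lvl n c'})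
    (fun n => Set.inter_subset_inter_right S fun w => lvl_mono n.le_succ)
    H (hc 0).isCompact hc
  rw [Set.mem_iInter] at hw
  exact ⟨w, (hw 0).1, eq_of_lvl fun n => (hw n).2⟩

/-- A closed submonoid of `W` is closed under inversion. -/
theorem inv_mem_of_isClosed {S : Submonoid W} (hS : IsClosed (S : Set W)) {w : W} (hw : w ∈ S) :
    w⁻¹ ∈ S := by
  -- The inverse is the limit of the positive powers $w^{2^n-1}$.
  have H : ∀ n, lvl n (w ^ (2 ^ n - 1)) = lvl n w⁻¹ := fun n => by
    rw [map_inv, eq_inv_iff_mul_eq_one, ← map_mul, ← pow_succ,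
      Nat.sub_add_cancel Nat.one_le_two_pow, lvl_pow]
  change w⁻¹ ∈ (S : Set W)
  rw [← hS.closure_eq]
  refine mem_closure_of_tendsto (f := fun n => w ^ (2 ^ n - 1)) (b := atTop) ?_
    (Eventually.of_forall fun n => S.pow_mem hw _)
  rw [nhds_eq, tendsto_iInf]
  refine fun t => tendsto_principal.2 ?_
  filter_upwards [eventually_ge_atTop t.length] with n hn
  exact lvl_eq_iff.1 (H n) t hn

end BinTree

/-! ### The structure of $G$: diagonal, $H$ and commutators -/

namespace BinTree

open scoped commutatorElement

variable (r : ℕ) [NeZero r]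

/-- The index of the last generator. -/
def lastIdx : Fin r := ⟨r - 1, Nat.sub_one_lt (NeZero.ne r)⟩

theorem isClosed_G : IsClosed (G r : Set W) := Subgroup.isClosed_topologicalClosure _

theorem gen_mem (i : Fin r) : gen r i ∈ G r :=
  Subgroup.le_topologicalClosure _ (Subgroup.subset_closure ⟨i, rfl⟩)

variable {r}

theorem G_le {S : Subgroup W} (hS : IsClosed (S : Set W)) (h : ∀ i, gen r i ∈ S) : G r ≤ S :=
  Subgroup.topologicalClosure_minimal _ ((Subgroup.closure_le _).2 (Set.range_subset_iff.2 h)) hS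

theorem gen_zero : gen r 0 = pair (gen r (lastIdx r)) 1 * swap := gen_first r

/-- Every generator is the first one or is of the form `(a, 1)` with `a` a generator that is not
the last one. -/
theorem gen_cases {p : Fin r → Prop} (h0 : p 0)
    (hs : ∀ i j : Fin r, j ≠ lastIdx r → gen r i = pair (gen r j) 1 → i.val = j.val + 1 → p i)
    (i : Fin r) : p i := by
  obtain ⟨_ | i, hi⟩ := i
  · exact h0
  · refine hs _ ⟨i, Nat.lt_of_succ_lt hi⟩ (fun h => ?_) (gen_next r i hi) rfl
    have : i = r - 1 := congrArg Fin.val h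
    omega

theorem exists_gen_eq_pair {j : Fin r} (hj : j ≠ lastIdx r) :
    ∃ i : Fin r, gen r i = pair (gen r j) 1 := by
  have h1 : j.val ≠ r - 1 := fun h => hj (Fin.ext h)
  have h2 : j.val + 1 < r := by have := j.isLt; omega
  exact ⟨⟨j.val + 1, h2⟩, gen_next r j h2⟩

/-- The sections of the elements of `G` lie in `G`. -/
theorem sec_mem {g : W} (hg : g ∈ G r) (b : Bool) : sec g b ∈ G r := by
  let S : Subgroup W :=
    { carrier := {g | ∀ b, sec g b ∈ G r}
      one_mem' := fun _ => (G r).one_mem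
      mul_mem' := fun {x y} hx hy b => by
        rw [sec_mul]
        exact (G r).mul_mem (hx _) (hy _)
      inv_mem' := fun {x} hx b => by
        rw [sec_inv]
        exact (G r).inv_mem (hx _) }
  have hS : IsClosed (S : Set W) := by
    have : (S : Set W) = ⋂ b, {g | sec g b ∈ G r} := by
      ext g
      simp [S]
    rw [this]
    exact isClosed_iInter fun b => (isClosed_G r).preimage (continuous_sec b)
  refine G_le hS (fun i => ?_) hg b
  refine gen_cases (p := fun i => gen r i ∈ S) ?_ (fun i j _ h _ => ?_) i
  · rintro (_ | _)
    · rw [gen_zero, sec_pair_mul_swap_false]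
      exact (G r).one_mem
    · rw [gen_zero, sec_pair_mul_swap_true]
      exact gen_mem r _
  · rintro (_ | _)
    · rw [h, sec_pair_false]
      exact gen_mem r _
    · rw [h, sec_pair_true]
      exact (G r).one_mem

theorem gen_zero_conj (u v : W) : gen r 0 * pair u v * (gen r 0)⁻¹ =
    pair (gen r (lastIdx r) * v * (gen r (lastIdx r))⁻¹) u := by
  rw [mul_inv_eq_iff_eq_mul, gen_zero, mul_assoc, swap_mul_pair, ← mul_assoc, ← mul_assoc,
    pair_mul_pair, pair_mul_pair]
  simp

theorem gen_zero_sq :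
    gen r 0 * gen r 0 = pair (gen r (lastIdx r)) (gen r (lastIdx r)) := by
  rw [gen_zero, mul_assoc, ← mul_assoc swap, swap_mul_pair, mul_assoc (pair _ _) swap swap,
    swap_mul_swap, mul_one, pair_mul_pair, mul_one, one_mul]

/-- Conjugation by $a_1$ moves the first coordinate to the second unchanged. -/
theorem pair_one_swap_mem {h : W} (hh : pair h 1 ∈ G r) : pair 1 h ∈ G r := by
  have := (G r).mul_mem ((G r).mul_mem (gen_mem r 0) hh) ((G r).inv_mem (gen_mem r 0))
  rwa [gen_zero_conj, mul_one, mul_inv_cancel] at this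

/-- `G` contains the diagonal. -/
theorem pair_self_mem {g : W} (hg : g ∈ G r) : pair g g ∈ G r := by
  let δ : W →* W := pairHom.comp ((MonoidHom.id W).prod (MonoidHom.id W))
  have hδ : Continuous δ := continuous_pair.comp (by fun_prop : Continuous fun g : W => (g, g))
  refine G_le (S := (G r).comap δ) ((isClosed_G r).preimage hδ) (fun j => ?_) hg
  change pair (gen r j) (gen r j) ∈ G r
  -- $(a_r,a_r)$ is $a_1^2$; for the other generators $(a_j,a_j)=(a_j,1)(1,a_j)$.
  by_cases hj : j = lastIdx r
  · rw [hj, ← gen_zero_sq]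
    exact (G r).mul_mem (gen_mem r 0) (gen_mem r 0)
  · obtain ⟨i, hi⟩ := exists_gen_eq_pair hj
    have h1 : pair (gen r j) 1 ∈ G r := hi ▸ gen_mem r i
    have := (G r).mul_mem h1 (pair_one_swap_mem h1)
    rwa [pair_mul_pair, mul_one, one_mul] at this

variable (r)

/-- The closed normal subgroup of `G` generated by all generators but the last one. -/
def H : Subgroup W :=
  (Subgroup.closure {x | ∃ g ∈ G r, ∃ j ≠ lastIdx r, x = g * gen r j * g⁻¹}).topologicalClosure

theorem isClosed_H : IsClosed (H r : Set W) := Subgroup.isClosed_topologicalClosure _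

variable {r}

theorem H_le {S : Subgroup W} (hS : IsClosed (S : Set W))
    (h : ∀ g ∈ G r, ∀ j ≠ lastIdx r, g * gen r j * g⁻¹ ∈ S) : H r ≤ S := by
  refine Subgroup.topologicalClosure_minimal _ ((Subgroup.closure_le _).2 ?_) hS
  rintro _ ⟨g, hg, j, hj, rfl⟩
  exact h g hg j hj

theorem conj_gen_mem_H {g : W} (hg : g ∈ G r) {j : Fin r} (hj : j ≠ lastIdx r) :
    g * gen r j * g⁻¹ ∈ H r :=
  Subgroup.le_topologicalClosure _ (Subgroup.subset_closure ⟨g, hg, j, hj, rfl⟩)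

theorem gen_mem_H {j : Fin r} (hj : j ≠ lastIdx r) : gen r j ∈ H r := by
  simpa using conj_gen_mem_H (G r).one_mem hj

theorem conj_mem_H {g h : W} (hg : g ∈ G r) (hh : h ∈ H r) : g * h * g⁻¹ ∈ H r := by
  have hc : Continuous (MulAut.conj g).toMonoidHom := by
    change Continuous fun h : W => g * h * g⁻¹
    fun_prop
  refine H_le (S := (H r).comap (MulAut.conj g).toMonoidHom) ((isClosed_H r).preimage hc)
    (fun x hx j hj => ?_) hh
  have := conj_gen_mem_H ((G r).mul_mem hg hx) hj
  simpa [mul_assoc] using this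

/-- If $a_j$ is not the last generator, $(a_j,1)$ is itself a generator, and the diagonal $(g,g)$
conjugates it to $(ga_jg^{-1},1)$. -/
theorem pair_one_mem {h : W} (hh : h ∈ H r) : pair h 1 ∈ G r := by
  let δ : W →* W := pairHom.comp (MonoidHom.inl W W)
  have hδ : Continuous δ :=
    continuous_pair.comp (by fun_prop : Continuous fun g : W => (g, (1 : W)))
  refine H_le (S := (G r).comap δ) ((isClosed_G r).preimage hδ) (fun g hg j hj => ?_) hh
  change pair (g * gen r j * g⁻¹) 1 ∈ G r
  obtain ⟨i, hi⟩ := exists_gen_eq_pair hj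
  have h1 : pair (gen r j) 1 ∈ G r := hi ▸ gen_mem r i
  have := (G r).mul_mem ((G r).mul_mem (pair_self_mem hg) h1) ((G r).inv_mem (pair_self_mem hg))
  rwa [pair_inv, pair_mul_pair, pair_mul_pair, mul_one, mul_inv_cancel] at this

/-- $(x,y)=(x,x)(1,x^{-1}y)$. -/
theorem pair_mem {x y : W} (hx : x ∈ G r) (hxy : x⁻¹ * y ∈ H r) : pair x y ∈ G r := by
  have := (G r).mul_mem (pair_self_mem hx) (pair_one_swap_mem (pair_one_mem hxy))
  rwa [pair_mul_pair, mul_one, mul_inv_cancel_left] at this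

/-- A closed subgroup that is normalized by `G` and contains all generators of `G` but one
contains the commutator subgroup of `G`. -/
theorem commutator_mem {S : Subgroup W} (hS : IsClosed (S : Set W))
    (hn : ∀ g ∈ G r, ∀ s ∈ S, g * s * g⁻¹ ∈ S) (i : Fin r) (hi : ∀ j ≠ i, gen r j ∈ S)
    {x y : W} (hx : x ∈ G r) (hy : y ∈ G r) : ⁅x, y⁆ ∈ S := by
  -- Being closed subgroups, these sets reduce the claim to generators, in each of the two arguments
  -- in turn.
  let C : W → Subgroup W := fun x =>
    { carrier := {y | y ∈ G r ∧ ⁅x, y⁆ ∈ S}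
      one_mem' := ⟨(G r).one_mem, by rw [commutatorElement_one_right]; exact S.one_mem⟩
      mul_mem' := by
        rintro a b ⟨ha, ha'⟩ ⟨hb, hb'⟩
        refine ⟨(G r).mul_mem ha hb, ?_⟩
        have := S.mul_mem ha' (hn a ha _ hb')
        simpa [commutatorElement_def, mul_assoc] using this
      inv_mem' := by
        rintro a ⟨ha, ha'⟩
        refine ⟨(G r).inv_mem ha, ?_⟩
        have := hn _ ((G r).inv_mem ha) _ (S.inv_mem ha')
        simpa [commutatorElement_def, mul_assoc] using this }
  have hC : ∀ x, IsClosed (C x : Set W) := fun x => by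
    have hc : Continuous fun y : W => ⁅x, y⁆ := by
      simp only [commutatorElement_def]
      fun_prop
    exact (isClosed_G r).inter (hS.preimage hc)
  have symm : ∀ {x y : W}, ⁅x, y⁆ ∈ S → ⁅y, x⁆ ∈ S := fun {x y} h => by
    rw [← commutatorElement_inv]
    exact S.inv_mem h
  have left : ∀ {s g : W}, s ∈ S → g ∈ G r → ⁅s, g⁆ ∈ S := fun {s g} hs hg => by
    have := S.mul_mem hs (hn g hg _ (S.inv_mem hs))
    simpa [commutatorElement_def, mul_assoc] using this
  have h1 : ∀ j, ∀ g ∈ G r, ⁅gen r j, g⁆ ∈ S := by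
    intro j g hg
    by_cases hj : j = i
    · refine (G_le (hC (gen r j)) (fun k => ⟨gen_mem r k, ?_⟩) hg).2
      by_cases hk : k = i
      · rw [hj, hk, commutatorElement_self]
        exact S.one_mem
      · exact symm (left (hi k hk) (gen_mem r j))
    · exact left (hi j hj) hg
  exact (G_le (hC x) (fun j => ⟨gen_mem r j, symm (h1 j x hx)⟩) hy).2

variable (r)

/-- The subgroup `H × H` of `G`. -/
def HH : Subgroup W := ((H r).prod (H r)).map pairHom

variable {r}

theorem pair_mem_HH {u v : W} : pair u v ∈ HH r ↔ u ∈ H r ∧ v ∈ H r := by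
  constructor
  · rintro ⟨⟨a, b⟩, ⟨ha, hb⟩, h⟩
    obtain ⟨rfl, rfl⟩ := pair_injective h
    exact ⟨ha, hb⟩
  · exact fun h => ⟨(u, v), h, rfl⟩

theorem isClosed_HH : IsClosed (HH r : Set W) := by
  have : (HH r : Set W) = (fun p : W × W => pair p.1 p.2) '' ((H r : Set W) ×ˢ (H r : Set W)) :=
    rfl
  rw [this]
  exact (((isClosed_H r).isCompact.prod (isClosed_H r).isCompact).image continuous_pair).isClosed

theorem conj_mem_HH {g h : W} (hg : g ∈ G r) (hh : h ∈ HH r) : g * h * g⁻¹ ∈ HH r := by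
  obtain ⟨⟨a, b⟩, ⟨ha, hb⟩, rfl⟩ := hh
  change g * pair a b * g⁻¹ ∈ HH r
  have h0 := sec_mem hg false
  have h1 := sec_mem hg true
  cases hact : act g false
  · rw [eq_pair hact, pair_inv, pair_mul_pair, pair_mul_pair, pair_mem_HH]
    exact ⟨conj_mem_H h0 ha, conj_mem_H h1 hb⟩
  · have key : ∀ u v : W, (pair u v * swap) * pair a b * (pair u v * swap)⁻¹ =
        pair (u * b * u⁻¹) (v * a * v⁻¹) := fun u v => by
      rw [mul_inv_eq_iff_eq_mul, mul_assoc, swap_mul_pair, ← mul_assoc, ← mul_assoc,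
        pair_mul_pair, pair_mul_pair, inv_mul_cancel_right, inv_mul_cancel_right]
    rw [eq_pair_mul_swap hact, key, pair_mem_HH]
    exact ⟨conj_mem_H h1 hb, conj_mem_H h0 ha⟩

/-- All generators except $a_1$ have the form $(a_j,1)$ with $a_j\in H$. -/
theorem commutator_mem_HH {x y : W} (hx : x ∈ G r) (hy : y ∈ G r) : ⁅x, y⁆ ∈ HH r := by
  refine commutator_mem isClosed_HH (fun g hg s hs => conj_mem_HH hg hs) 0 (fun j => ?_) hx hy
  refine gen_cases (p := fun j => j ≠ 0 → gen r j ∈ HH r) (fun h => absurd rfl h)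
    (fun i j hj h _ _ => ?_) j
  rw [h, pair_mem_HH]
  exact ⟨gen_mem_H hj, (H r).one_mem⟩

theorem commutator_mem_H {x y : W} (hx : x ∈ G r) (hy : y ∈ G r) : ⁅x, y⁆ ∈ H r :=
  commutator_mem (isClosed_H r) (fun _ hg _ hs => conj_mem_H hg hs) (lastIdx r)
    (fun _ hj => gen_mem_H hj) hx hy

end BinTree

/-! ### Conjugacy under $G$ of elements with the same class in $G_{\mathrm{ab}}$ -/

namespace BinTree

open scoped commutatorElement

theorem pair_conj_pair_mul_swap (x y u v : W) :
    pair x y * (pair u v * swap) * (pair x y)⁻¹ = pair (x * u * y⁻¹) (y * v * x⁻¹) * swap := by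
  rw [mul_inv_eq_iff_eq_mul, mul_assoc, swap_mul_pair, ← mul_assoc, ← mul_assoc,
    pair_mul_pair, pair_mul_pair, inv_mul_cancel_right, inv_mul_cancel_right]

theorem sgn_stdOdometer (n : ℕ) : sgn n stdOdometer = -1 := by
  induction n with
  | zero =>
    rw [stdOdometer_eq, sgn, act_pair_mul_swap]
    rfl
  | succ n ih =>
    rw [stdOdometer_eq, sgn, sec_pair_mul_swap_false, sec_pair_mul_swap_true, ih,
      show sgn n 1 = 1 from (sgnHom n).map_one, one_mul]

theorem IsOdometer.sgn_eq {c : W} (hc : IsOdometer c) (n : ℕ) : sgn n c = -1 := by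
  obtain ⟨w, rfl⟩ := isConj_iff.1 hc
  rw [sgn_conj, sgn_stdOdometer]

theorem continuous_sgn (n : ℕ) : Continuous (sgn n) :=
  ((IsLocallyConstant.iff_exists_open _).2 fun x =>
    ⟨_, isOpen_lvl (n + 1) x, rfl, fun _ hy => sgn_eq_of_lvl hy⟩).continuous

theorem act_of_sgn {g : W} (h : sgn 0 g = -1) : act g false = true := by
  by_contra hne
  rw [sgn, if_neg hne] at h
  exact absurd h (by decide)

variable {r : ℕ} [NeZero r]

/-- Elements with the same image in the topological abelianization differ by an element of every
closed subgroup that contains the commutators. -/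
theorem inv_mul_mem_of_mk_eq {c c' : G r}
    (h : (QuotientGroup.mk c : TopologicalAbelianization (G r)) = QuotientGroup.mk c')
    {S : Subgroup (G r)} (hS : IsClosed (S : Set (G r))) (hc : ∀ x y : G r, ⁅x, y⁆ ∈ S) :
    c⁻¹ * c' ∈ S := by
  have h1 : commutator (G r) ≤ S := Subgroup.commutator_le.2 fun x _ y _ => hc x y
  exact Subgroup.topologicalClosure_minimal _ h1 hS (QuotientGroup.eq.1 h)

theorem inv_mul_mem_HH_of_mk_eq {c c' : G r}
    (h : (QuotientGroup.mk c : TopologicalAbelianization (G r)) = QuotientGroup.mk c') :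
    (c : W)⁻¹ * c' ∈ HH r :=
  inv_mul_mem_of_mk_eq h (S := (HH r).comap (G r).subtype)
    (isClosed_HH.preimage continuous_subtype_val) fun x y => commutator_mem_HH x.2 y.2

/-- The section of an element of `G` at a child of the root, as an element of `G`. -/
def secG (g : G r) (b : Bool) : G r := ⟨sec g b, sec_mem g.2 b⟩

variable (r) in
/-- The homomorphism that maps `(u, v)` and `(u, v) σ` to the class of `u v`. -/
def transferHom : G r →* TopologicalAbelianization (G r) :=
  MonoidHom.mk' (fun g => QuotientGroup.mk (secG g true) * QuotientGroup.mk (secG g false))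
    (fun g h => by
      have key : ∀ b, secG (g * h) b = secG g (act h b) * secG h b :=
        fun b => Subtype.ext (sec_mul g h b)
      have hh := act_true (h : W)
      rw [key, key, QuotientGroup.mk_mul, QuotientGroup.mk_mul, hh]
      cases act (h : W) false <;>
        simp only [Bool.not_true, Bool.not_false, mul_comm, mul_left_comm, mul_assoc])

theorem continuous_transferHom : Continuous (transferHom r) := by
  have h : ∀ b, Continuous fun g : G r => secG g b := fun b =>
    ((continuous_sec b).comp continuous_subtype_val).subtype_mk _
  have h' : ∀ b, Continuous fun g : G r =>
      (QuotientGroup.mk (secG g b) : TopologicalAbelianization (G r)) := fun b =>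
    QuotientGroup.continuous_mk.comp (h b)
  exact (h' true).mul (h' false)

theorem transferHom_eq_of_mk_eq {c c' : G r}
    (h : (QuotientGroup.mk c : TopologicalAbelianization (G r)) = QuotientGroup.mk c') :
    transferHom r c = transferHom r c' := by
  -- This makes points closed in the abelianization, so that the kernel below is closed.
  have : IsClosed ((commutator (G r)).topologicalClosure : Set (G r)) :=
    Subgroup.isClosed_topologicalClosure _
  have h1 : IsClosed ((transferHom r).ker : Set (G r)) :=
    isClosed_singleton.preimage continuous_transferHom
  have h2 := inv_mul_mem_of_mk_eq h h1 fun x y => by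
    rw [MonoidHom.mem_ker, map_commutatorElement, commutatorElement_eq_one_iff_mul_comm, mul_comm]
  rw [MonoidHom.mem_ker, map_mul, map_inv, inv_mul_eq_one] at h2
  exact h2

theorem sgn_eq_of_mk_eq {c c' : G r}
    (h : (QuotientGroup.mk c : TopologicalAbelianization (G r)) = QuotientGroup.mk c') (n : ℕ) :
    sgn n c = sgn n c' := by
  let f := (sgnHom n).comp (G r).subtype
  have h1 : IsClosed (f.ker : Set (G r)) :=
    isClosed_singleton.preimage ((continuous_sgn n).comp continuous_subtype_val)
  have h2 := inv_mul_mem_of_mk_eq h h1 fun x y => by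
    rw [MonoidHom.mem_ker, map_commutatorElement, commutatorElement_eq_one_iff_mul_comm, mul_comm]
  rw [MonoidHom.mem_ker, map_mul, map_inv, inv_mul_eq_one] at h2
  exact h2

/-- Elements of `G` that act on all levels with sign `-1` and have the same image in the
topological abelianization are conjugate under `G` on every level. -/
theorem exists_lvl_conj (n : ℕ) : ∀ c c' : G r, (∀ j, sgn j c = -1) →
    (QuotientGroup.mk c : TopologicalAbelianization (G r)) = QuotientGroup.mk c' →
    ∃ x ∈ G r, lvl n (x * c * x⁻¹) = lvl n c' := by
  induction n with
  | zero => exact fun _ _ _ _ => ⟨1, (G r).one_mem, lvl_zero _ _⟩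
  | succ n ih =>
    intro c c' hc h
    have hc' : ∀ j, sgn j c' = -1 := fun j => (sgn_eq_of_mk_eq h j).symm.trans (hc j)
    obtain ⟨u, hu⟩ : ∃ u, secG c true = u := ⟨_, rfl⟩
    obtain ⟨v, hv⟩ : ∃ v, secG c false = v := ⟨_, rfl⟩
    obtain ⟨u', hu'⟩ : ∃ u, secG c' true = u := ⟨_, rfl⟩
    obtain ⟨v', hv'⟩ : ∃ v, secG c' false = v := ⟨_, rfl⟩
    have ec : (c : W) = pair u v * swap := by
      rw [← hu, ← hv]
      exact eq_pair_mul_swap (act_of_sgn (hc 0))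
    have ec' : (c' : W) = pair u' v' * swap := by
      rw [← hu', ← hv']
      exact eq_pair_mul_swap (act_of_sgn (hc' 0))
    have hsgn : ∀ j, sgn j (u * v : G r) = -1 := fun j => by
      have := hc (j + 1)
      rw [sgn, ec, sec_pair_mul_swap_false, sec_pair_mul_swap_true, mul_comm] at this
      exact (sgn_mul j u v).trans this
    have hmk : (QuotientGroup.mk (u * v) : TopologicalAbelianization (G r)) =
        QuotientGroup.mk (u' * v') := by
      have := transferHom_eq_of_mk_eq h
      rw [← hu, ← hv, ← hu', ← hv']
      exact this
    obtain ⟨x, hx, hxl⟩ := ih _ _ hsgn hmk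
    -- $c^{-1}c'=(v^{-1}v',u^{-1}u')$ lies in $H\times H$; the second coordinate is needed.
    have hH : (u : W)⁻¹ * u' ∈ H r := by
      have := inv_mul_mem_HH_of_mk_eq h
      rw [ec, ec', mul_inv_rev, pair_inv, mul_assoc, ← mul_assoc (pair _ _) (pair _ _),
        pair_mul_pair, ← mul_assoc, swap_inv, swap_mul_pair, mul_assoc, swap_mul_swap, mul_one,
        pair_mem_HH] at this
      exact this.2
    -- The second coordinate is forced by requiring the conjugate of $c$ to have first entry exactly
    -- $u'$.
    refine ⟨pair x ((u' : W)⁻¹ * x * u), pair_mem hx ?_, ?_⟩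
    · have h1 : (x : W)⁻¹ * ((u' : W)⁻¹ * x * u) =
          ⁅(x : W)⁻¹, (u' : W)⁻¹⁆ * ((u : W)⁻¹ * u')⁻¹ := by group
      rw [h1]
      exact (H r).mul_mem (commutator_mem_H ((G r).inv_mem hx) ((G r).inv_mem u'.2))
        ((H r).inv_mem hH)
    · have h1 : pair x ((u' : W)⁻¹ * x * u) * c * (pair x ((u' : W)⁻¹ * x * u))⁻¹ =
          pair u' ((u' : W)⁻¹ * (x * (u * v) * x⁻¹)) * swap := by
        rw [ec, pair_conj_pair_mul_swap]
        congr 2; group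
      rw [h1, ec', map_mul, map_mul]
      congr 1
      refine lvl_pair rfl ?_
      have h2 : lvl n (x * (u * v) * x⁻¹) = lvl n (u' * v') := hxl
      rw [map_mul, h2, ← map_mul, inv_mul_cancel_left]

theorem exists_conj_of_mk_eq {c c' : G r} (hc : ∀ j, sgn j c = -1)
    (h : (QuotientGroup.mk c : TopologicalAbelianization (G r)) = QuotientGroup.mk c') :
    ∃ x : G r, x * c * x⁻¹ = c' := by
  obtain ⟨x, hx, hxc⟩ := exists_conj_of_lvl (isClosed_G r) fun n => exists_lvl_conj n c c' hc h
  exact ⟨⟨x, hx⟩, Subtype.ext hxc⟩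

end BinTree

/-! ### Conjugating the generators to odd powers -/

namespace BinTree

open scoped commutatorElement

variable {r : ℕ} [NeZero r]

theorem gen_zero_zpow (m : ℤ) : gen r 0 ^ (2 * m + 1) =
    pair (gen r (lastIdx r) ^ (m + 1)) (gen r (lastIdx r) ^ m) * swap := by
  have h : pair (gen r (lastIdx r)) (gen r (lastIdx r)) ^ m =
      pair (gen r (lastIdx r) ^ m) (gen r (lastIdx r) ^ m) :=
    (map_zpow pairHom (gen r (lastIdx r), gen r (lastIdx r)) m).symm
  rw [zpow_add, zpow_mul, zpow_one, zpow_two, gen_zero_sq, h, gen_zero, ← mul_assoc,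
    pair_mul_pair, mul_one, zpow_add_one]

/-- Induction along the recursion of the generators: a solution one level lower, for shifted
exponents, is placed in both coordinates up to a correction that handles $a_1$. -/
theorem exists_conj_gen_lvl (n : ℕ) : ∀ k : Fin r → ℤ, (∀ i, Odd (k i)) →
    ∃ w : W, ∀ i, ∃ g ∈ G r, lvl n (w * gen r i * w⁻¹) = lvl n (g * gen r i ^ k i * g⁻¹) := by
  induction n with
  | zero => exact fun _ _ => ⟨1, fun _ => ⟨1, (G r).one_mem, lvl_zero _ _⟩⟩
  | succ n ih =>
    intro k hk
    -- Each generator gets the exponent of the generator in which it occurs as a section; the last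
    -- one occurs in `gen r 0`.
    obtain ⟨z, hz⟩ := ih (fun j => if h : j.val + 1 < r then k ⟨j.val + 1, h⟩ else k 0)
      fun j => by split_ifs <;> exact hk _
    obtain ⟨g, hg, hgz⟩ := hz (lastIdx r)
    have hlast : ¬ (lastIdx r).val + 1 < r := by
      change ¬ r - 1 + 1 < r
      omega
    simp only [hlast, dite_false] at hgz
    obtain ⟨m, hm⟩ := hk 0
    -- Now `x` takes the last generator to its power itself, not just to a conjugate, on level `n`.
    obtain ⟨x, hx⟩ : ∃ x, x = g⁻¹ * z := ⟨_, rfl⟩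
    have hxz : ∀ a, x * a * x⁻¹ = g⁻¹ * (z * a * z⁻¹) * g := fun a => by rw [hx]; group
    have hxl : lvl n (x * gen r (lastIdx r) * x⁻¹) = lvl n (gen r (lastIdx r) ^ k 0) := by
      rw [hxz, map_mul, map_mul, hgz, ← map_mul, ← map_mul]
      congr 1
      group
    -- With $b=a_r$, the second coordinate $y$ solves $xby^{-1}=b^{m+1}$; then $yx^{-1}=b^m$ on
    -- level `n`, as in `gen_zero_zpow`.
    refine ⟨pair x (gen r (lastIdx r) ^ (-(m + 1)) * x * gen r (lastIdx r)), fun i => ?_⟩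
    refine gen_cases (p := fun i => ∃ g ∈ G r, lvl (n + 1) (_ * gen r i * _) =
      lvl (n + 1) (g * gen r i ^ k i * g⁻¹)) ⟨1, (G r).one_mem, ?_⟩ (fun i j hj h hij => ?_) i
    · rw [one_mul, inv_one, mul_one, hm, gen_zero_zpow, gen_zero, pair_conj_pair_mul_swap,
        map_mul, map_mul]
      congr 1
      refine lvl_pair (congrArg _ (by group)) ?_
      rw [mul_one, mul_assoc, mul_assoc, ← mul_assoc x, map_mul, hxl, ← map_mul, ← zpow_add, hm]
      congr 2
      ring
    · obtain ⟨g', hg', hl⟩ := hz j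
      have hlt : j.val + 1 < r := hij ▸ i.isLt
      have hi : (⟨j.val + 1, hlt⟩ : Fin r) = i := Fin.ext hij.symm
      simp only [hlt, dite_true, hi] at hl
      have hpow : pair (gen r j) 1 ^ k i = pair (gen r j ^ k i) 1 := by
        have := map_zpow pairHom (gen r j, 1) (k i)
        rw [Prod.pow_mk, one_zpow] at this
        exact this.symm
      refine ⟨_, pair_self_mem ((G r).mul_mem ((G r).inv_mem hg) hg'), ?_⟩
      rw [h, hpow, pair_inv, pair_inv, pair_mul_pair, pair_mul_pair, pair_mul_pair, pair_mul_pair]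
      refine lvl_pair ?_ (congrArg _ (by group))
      rw [hxz, map_mul, map_mul, hl, ← map_mul, ← map_mul, mul_inv_rev, inv_inv]
      congr 1

theorem exists_conj_gen {k : Fin r → ℤ} (hk : ∀ i, Odd (k i)) :
    ∃ w : W, ∀ i, ∃ g ∈ G r, w * gen r i * w⁻¹ = g * gen r i ^ k i * g⁻¹ := by
  -- The conjugator and the elements of $G$ must converge together, hence compactness of the
  -- product.
  let C : ℕ → Set (W × (Fin r → W)) := fun n => {p | ∀ i, p.2 i ∈ G r ∧
    lvl n (p.1 * gen r i * p.1⁻¹) = lvl n (p.2 i * gen r i ^ k i * (p.2 i)⁻¹)}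
  have hC : ∀ n, IsClosed (C n) := fun n => by
    simp only [C, Set.ofPred_forall, Set.ofPred_and]
    refine isClosed_iInter fun i => ((isClosed_G r).preimage (by fun_prop)).inter ?_
    exact isClosed_eq ((continuous_lvl n).comp (by fun_prop))
      ((continuous_lvl n).comp (by fun_prop))
  obtain ⟨p, hp⟩ := IsCompact.nonempty_iInter_of_sequence_nonempty_isCompact_isClosed C
    (fun n p hp i => ⟨(hp i).1, lvl_mono n.le_succ (hp i).2⟩)
    (fun n => by
      obtain ⟨w, hw⟩ := exists_conj_gen_lvl n k hk
      choose g hg hgw using hw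
      exact ⟨(w, g), fun i => ⟨hg i, hgw i⟩⟩) (hC 0).isCompact hC
  rw [Set.mem_iInter] at hp
  exact ⟨p.1, fun i => ⟨p.2 i, (hp 0 i).1, eq_of_lvl fun n => (hp n i).2⟩⟩

/-! ### The normalizer, exponents modulo commutators, and conjugacy under $N$ -/

variable (r)

/-- The submonoid of the elements that conjugate `G` into itself. -/
def conjInto : Submonoid W where
  carrier := {w | ∀ g ∈ G r, w * g * w⁻¹ ∈ G r}
  one_mem' := fun g hg => by simpa using hg
  mul_mem' := fun {a b} ha hb g hg => by
    have := ha _ (hb g hg)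
    rwa [show a * (b * g * b⁻¹) * a⁻¹ = a * b * g * (a * b)⁻¹ by group] at this

theorem isClosed_conjInto : IsClosed (conjInto r : Set W) := by
  have : (conjInto r : Set W) = ⋂ g ∈ G r, {w | w * g * w⁻¹ ∈ G r} := by
    ext w
    simp [conjInto]
  rw [this]
  exact isClosed_biInter fun g _ => (isClosed_G r).preimage (by fun_prop)

variable {r}

theorem mem_N_iff {w : W} : w ∈ N r ↔ w ∈ conjInto r := by
  refine Subgroup.mem_normalizer_iff.trans
    ⟨fun h g hg => (h g).1 hg, fun h g => ⟨h g, fun hg => ?_⟩⟩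
  have := inv_mem_of_isClosed (isClosed_conjInto r) h _ hg
  rwa [show w⁻¹ * (w * g * w⁻¹) * w⁻¹⁻¹ = g by group] at this

theorem isClosed_N : IsClosed (N r : Set W) := by
  convert isClosed_conjInto r using 1
  ext w
  exact mem_N_iff

theorem mem_N_of_conj_gen {w : W} (h : ∀ i, w * gen r i * w⁻¹ ∈ G r) : w ∈ N r := by
  have hc : Continuous (MulAut.conj w).toMonoidHom := by
    change Continuous fun h : W => w * h * w⁻¹
    fun_prop
  exact mem_N_iff.2 fun g hg =>
    G_le (S := (G r).comap (MulAut.conj w).toMonoidHom) ((isClosed_G r).preimage hc) h hg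

theorem sgn_gen {j : ℕ} (hj : j < r) (i : Fin r) : sgn j (gen r i) = if j = i then -1 else 1 := by
  have hs1 : ∀ j, sgn j 1 = 1 := fun j => (sgnHom j).map_one
  induction j generalizing i with
  | zero =>
    refine gen_cases (p := fun i => sgn 0 (gen r i) = if 0 = i.val then -1 else 1) ?_
      (fun i j _ h hij => ?_) i
    · rw [gen_zero, sgn, act_pair_mul_swap]
      simp
    · rw [h, sgn, act_pair, hij]
      simp
  | succ j ih =>
    have hj' : j < r := by omega
    refine gen_cases (p := fun i => sgn (j + 1) (gen r i) = if j + 1 = i.val then -1 else 1) ?_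
      (fun i j' _ h hij => ?_) i
    · have : j ≠ (lastIdx r).val := by
        change j ≠ r - 1
        omega
      rw [gen_zero, sgn, sec_pair_mul_swap_false, sec_pair_mul_swap_true, hs1, ih hj', if_neg this]
      simp
    · rw [h, sgn, sec_pair_false, sec_pair_true, hs1, ih hj', mul_one, hij]
      simp

/-- The generators as elements of `G`. -/
def genG (i : Fin r) : G r := ⟨gen r i, gen_mem r i⟩

/-- Every element of `G` agrees on a given level with an element whose image under every
homomorphism to an abelian group is a product of powers of the images of the generators. -/
theorem exists_exponents (c : G r) (n : ℕ) : ∃ γ : G r, lvl n γ = lvl n c ∧ ∃ l : Fin r → ℤ,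
    ∀ (A : Type) [CommGroup A] (f : G r →* A), f γ = ∏ i, f (genG i) ^ l i := by
  obtain ⟨γ, hγ, hγc⟩ := exists_lvl_eq_of_mem_closure c.2 n
  have hle : Subgroup.closure (Set.range (gen r)) ≤ G r := Subgroup.le_topologicalClosure _
  refine ⟨⟨γ, hle hγ⟩, hγc, ?_⟩
  induction hγ using Subgroup.closure_induction generalizing c with
  | mem x hx =>
    obtain ⟨i, rfl⟩ := hx
    refine ⟨fun j => if j = i then 1 else 0, fun A _ f => ?_⟩
    rw [Finset.prod_eq_single i (fun j _ hj => by simp [hj]) (by simp)]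
    simp [genG]
  | one => exact ⟨0, fun A _ f => by
      simp only [Pi.zero_apply, zpow_zero, Finset.prod_const_one]
      exact f.map_one⟩
  | mul x y hx hy ihx ihy =>
    obtain ⟨l, hl⟩ := ihx ⟨x, hle hx⟩ rfl
    obtain ⟨l', hl'⟩ := ihy ⟨y, hle hy⟩ rfl
    refine ⟨l + l', fun A _ f => ?_⟩
    simp only [Pi.add_apply, zpow_add, Finset.prod_mul_distrib, ← hl, ← hl']
    exact f.map_mul ⟨x, hle hx⟩ ⟨y, hle hy⟩
  | inv x hx ih =>
    obtain ⟨l, hl⟩ := ih ⟨x, hle hx⟩ rfl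
    refine ⟨-l, fun A _ f => ?_⟩
    simp only [Pi.neg_apply, zpow_neg, Finset.prod_inv_distrib, ← hl]
    exact f.map_inv ⟨x, hle hx⟩

/-- The homomorphism `sgn i` is $-1$ on `gen r i` and trivial on the other generators, so it reads
off the parity of `l i`. -/
theorem odd_exponents {c γ : G r} {n : ℕ} (hn : r ≤ n) (hγ : lvl n γ = lvl n c) {l : Fin r → ℤ}
    (hl : ∀ (A : Type) [CommGroup A] (f : G r →* A), f γ = ∏ i, f (genG i) ^ l i)
    (hc : ∀ j, sgn j c = -1) (i : Fin r) : Odd (l i) := by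
  have h1 : sgn i γ = -1 := by
    rw [sgn_eq_of_lvl (lvl_mono (Nat.succ_le_of_lt (i.isLt.trans_le hn)) hγ), hc]
  have h2 : sgn i γ = ∏ j, sgn i (gen r j) ^ l j := hl _ ((sgnHom i).comp (G r).subtype)
  rw [h1, Finset.prod_eq_single i (fun j _ hj => by
    rw [sgn_gen i.isLt, if_neg fun h => hj (Fin.ext h.symm), one_zpow]) (by simp),
    sgn_gen i.isLt, if_pos rfl] at h2
  by_contra hodd
  rw [(Int.not_odd_iff_even.1 hodd).neg_one_zpow] at h2
  exact absurd h2 (by decide)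

variable (r) in
/-- The map from `G` to the abelianization of its image on the level `n`. -/
def lvlAb (n : ℕ) : G r →* Abelianization ((G r).map (lvl n)) :=
  Abelianization.of.comp ((lvl n).subgroupMap (G r))

theorem lvlAb_eq_of_lvl {n : ℕ} {c c' : G r} (h : lvl n c = lvl n c') :
    lvlAb r n c = lvlAb r n c' :=
  congrArg Abelianization.of (Subtype.ext h)

theorem exists_commutator_of_lvlAb_eq {n : ℕ} {c c' : G r} (h : lvlAb r n c = lvlAb r n c') :
    ∃ κ ∈ commutator (G r), lvl n (c * κ : G r) = lvl n c' := by
  let π := (lvl n).subgroupMap (G r)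
  have h1 : (π c)⁻¹ * π c' ∈ commutator ((G r).map (lvl n)) := QuotientGroup.eq.1 h
  rw [commutator_def, ← Subgroup.map_top_of_surjective π ((lvl n).subgroupMap_surjective (G r)),
    ← Subgroup.map_commutator] at h1
  obtain ⟨κ, hκ, hκ'⟩ := h1
  refine ⟨κ, hκ, ?_⟩
  have h2 : π (c * κ) = π c' := by rw [map_mul, hκ', mul_inv_cancel_left]
  exact congrArg Subtype.val h2

theorem exists_odd_mul_eq {a b : ℤ} (ha : Odd a) (hb : Odd b) (n : ℕ) :
    ∃ k t : ℤ, Odd k ∧ k * a = b + 2 ^ n * t := by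
  -- The exponent `n + 1` rather than `n` forces the Bézout coefficient of `a` to be odd even for `n
  -- = 0`.
  have h2 : IsCoprime a (2 ^ (n + 1)) := (Int.isCoprime_two_right.2 ha).pow_right
  obtain ⟨u, v, huv⟩ := h2
  refine ⟨u * b, -(2 * v * b), Odd.mul ?_ hb, by linear_combination b * huv⟩
  by_contra hu
  have h3 : Even (u * a + v * 2 ^ (n + 1)) :=
    ((Int.not_odd_iff_even.1 hu).mul_right a).add ⟨v * 2 ^ n, by ring⟩
  rw [huv] at h3
  exact absurd h3 (by decide)

/-- On level `n` exponents matter only modulo $2^n$, where odd numbers are invertible. This gives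
`w` with `w * c * w⁻¹` equal to `c' * κ` on level `n`, `κ` in the commutator subgroup; part (b) then
conjugates `c' * κ` to `c'`. -/
theorem exists_mem_N_lvl_conj {n : ℕ} (hn : r ≤ n) {c c' : G r} (hc : ∀ j, sgn j c = -1)
    (hc' : ∀ j, sgn j c' = -1) : ∃ w ∈ N r, lvl n (w * c * w⁻¹) = lvl n c' := by
  obtain ⟨γ, hγ, l, hl⟩ := exists_exponents c n
  obtain ⟨γ', hγ', l', hl'⟩ := exists_exponents c' n
  choose k t hk hkt using fun i =>
    exists_odd_mul_eq (odd_exponents hn hγ hl hc i) (odd_exponents hn hγ' hl' hc' i) n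
  obtain ⟨w, hw⟩ := exists_conj_gen hk
  choose g hg hwg using hw
  have hwN : w ∈ N r := mem_N_of_conj_gen fun i => by
    rw [hwg]
    exact (G r).mul_mem ((G r).mul_mem (hg i) ((G r).zpow_mem (gen_mem r i) _))
      ((G r).inv_mem (hg i))
  let θ : G r →* G r := MonoidHom.mk' (fun x => ⟨w * x * w⁻¹, mem_N_iff.1 hwN x x.2⟩)
    fun x y => Subtype.ext (show w * (x * y) * w⁻¹ = w * x * w⁻¹ * (w * y * w⁻¹) by group)
  have hθgen : ∀ i, lvlAb r n (θ (genG i)) = lvlAb r n (genG i) ^ k i := fun i => by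
    have : θ (genG i) = ⟨g i, hg i⟩ * genG i ^ k i * (⟨g i, hg i⟩ : G r)⁻¹ := Subtype.ext (hwg i)
    rw [this, map_mul, map_mul, map_inv, mul_inv_cancel_comm, map_zpow]
  have hpow : ∀ i, lvlAb r n (genG i) ^ (2 ^ n : ℤ) = 1 := fun i => by
    have h1 : lvlAb r n (genG i ^ 2 ^ n) = lvlAb r n 1 :=
      lvlAb_eq_of_lvl (by
        rw [Subgroup.coe_pow, lvl_pow, Subgroup.coe_one, map_one])
    rw [map_pow, map_one] at h1
    exact_mod_cast h1
  have hθl : lvl n (θ γ) = lvl n (θ c) := by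
    change lvl n (w * γ * w⁻¹) = lvl n (w * c * w⁻¹)
    rw [map_mul, map_mul, hγ, ← map_mul, ← map_mul]
  have key : lvlAb r n c' = lvlAb r n (θ c) := by
    rw [← lvlAb_eq_of_lvl hγ', ← lvlAb_eq_of_lvl hθl, hl' _ (lvlAb r n)]
    refine ((hl _ ((lvlAb r n).comp θ)).trans (Finset.prod_congr rfl fun i _ => ?_)).symm
    rw [MonoidHom.comp_apply, hθgen, ← zpow_mul, hkt, zpow_add, zpow_mul, hpow, one_zpow, mul_one]
  obtain ⟨κ, hκ, hκl⟩ := exists_commutator_of_lvlAb_eq key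
  have hmk : (QuotientGroup.mk (c' * κ) : TopologicalAbelianization (G r)) =
      QuotientGroup.mk c' := by
    refine QuotientGroup.eq.2 (Subgroup.le_topologicalClosure _ ?_)
    rw [mul_inv_rev, inv_mul_cancel_right]
    exact inv_mem hκ
  obtain ⟨x, hx⟩ := exists_conj_of_mk_eq
    (fun j => (sgn_eq_of_mk_eq hmk j).trans (hc' j)) hmk
  refine ⟨x * w, (N r).mul_mem (Subgroup.le_normalizer x.2) hwN, ?_⟩
  have h1 : lvl n (x * w * c * (x * w)⁻¹) = lvl n (x * θ c * (x : W)⁻¹) :=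
    congrArg _ (show x * w * c * (x * w)⁻¹ = x * (w * c * w⁻¹) * (x : W)⁻¹ by group)
  have h2 : lvl n (x * (c' * κ : G r) * (x : W)⁻¹) = lvl n c' :=
    congrArg (fun y : G r => lvl n y) hx
  rw [h1, map_mul, map_mul, ← hκl, ← map_mul, ← map_mul, h2]

end BinTree

theorem mainTheorem10 (r : ℕ) [NeZero r] :
    (∀ c ∈ BinTree.G r, ∀ c' ∈ BinTree.G r, BinTree.IsOdometer c → BinTree.IsOdometer c' →
      ∃ w ∈ BinTree.N r, w * c * w⁻¹ = c') ∧
    (∀ c c' : BinTree.G r,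
      BinTree.IsOdometer (c : BinTree.W) → BinTree.IsOdometer (c' : BinTree.W) →
      (QuotientGroup.mk c : TopologicalAbelianization (BinTree.G r)) = QuotientGroup.mk c' →
      ∃ x : BinTree.G r, x * c * x⁻¹ = c') := by
  refine ⟨fun c hc c' hc' ho ho' => ?_, fun c c' ho _ h =>
    BinTree.exists_conj_of_mk_eq ho.sgn_eq h⟩
  refine BinTree.exists_conj_of_lvl BinTree.isClosed_N fun n => ?_
  -- Level at least `r` is needed to see the parities of all exponents.
  obtain ⟨w, hw, h⟩ := BinTree.exists_mem_N_lvl_conj (le_max_left r n) (c := ⟨c, hc⟩)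
    (c' := ⟨c', hc'⟩) ho.sgn_eq ho'.sgn_eq
  exact ⟨w, hw, BinTree.lvl_mono (le_max_right r n) h⟩
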